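/- Let $k\in\{2,3\}$ and let $n\ge 0$ be an integer. For subsets $A,B$ of $[1..n]=\{1,\dots,n\}$ write $A\prec B$ if $a<b$ for all $a\in A$, $b\in B$. Two subsets $I,J\subseteq[1..n]$ are *weakly separated* if at least one of the following holds: (1) $|I|\ge|J|$ and $J\setminus I$ is a disjoint union $J'\sqcup J''$ with $J'\prec I\setminus J$ and $I\setminus J\prec J''$; (2) the same with $I$ and $J$ interchanged. Let $\mathbb{G}_{k,n}(\mathbb{C})$ be the Grassmannian of $k$-dimensional subspaces of $\mathbb{C}^n$. A $k\times n$ complex matrix $M$ represents $p\in\mathbb{G}_{k,n}(\mathbb{C})$ if its rows span $p$; its Plücker coordinates are the maximal minors $\Delta^I(M)$, where $I$ ranges over the $k$-subsets of $[1..n]$ and the columns indexed by $I$ are taken in increasing order. For a collection $\mathcal{C}$ of $k$-subsets of $[1..n]$, say that the coordinates $\Delta^I(p)$, $I\in\mathcal{C}$, are positive if $p$ is represented by some matrix $M$ with $\Delta^I(M)$ a positive real number for every $I\in\mathcal{C}$. The point $p$ is *positive* if this holds for the collection of all $k$-subsets of $[1..n]$. The collection $\mathcal{C}$ is a *positivity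 test* if, for every $p\in\mathbb{G}_{k,n}(\mathbb{C})$, the point $p$ is positive if and only if the coordinates $\Delta^I(p)$, $I\in\mathcal{C}$, are positive. **Theorem.** Let $\mathcal{C}$ be an inclusion-maximal collection of pairwise weakly separated $k$-subsets of $[1..n]$. Then $\mathcal{C}$ is a positivity test for $\mathbb{G}_{k,n}(\mathbb{C})$. Moreover, if $M$ is any $k\times n$ complex matrix representing a point of $\mathbb{G}_{k,n}(\mathbb{C})$ such that $\Delta^I(M)$ is real and positive for every $I\in\mathcal{C}$, then $\Delta^J(M)$ is real and positive for every $k$-subset $J$ of $[1..n]$. -/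

import Mathlib

namespace GrassmannPositivity

/-- `A ≺ B`: every element of `A` is smaller than every element of `B`. -/
def Precedes {n : ℕ} (A B : Finset (Fin n)) : Prop :=
  ∀ a ∈ A, ∀ b ∈ B, a < b

/-- One half of weak separation: `|I| ≥ |J|` and `J \ I` is a disjoint union `J' ⊔ J''` with
`J' ≺ I \ J ≺ J''`. -/
def Surrounds {n : ℕ} (I J : Finset (Fin n)) : Prop :=
  J.card ≤ I.card ∧ ∃ J' J'' : Finset (Fin n), Disjoint J' J'' ∧ J' ∪ J'' = J \ I ∧
    Precedes J' (I \ J) ∧ Precedes (I \ J) J''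

/-- Weakly separated subsets of the linearly ordered ground set `Fin n`. -/
def WeaklySeparated {n : ℕ} (I J : Finset (Fin n)) : Prop :=
  Surrounds I J ∨ Surrounds J I

/-- The `k`-element subsets of the ground set `Fin n`. -/
abbrev KSubset (k n : ℕ) : Type := {I : Finset (Fin n) // I.card = k}

/-- `C` is an inclusion-maximal collection of pairwise weakly separated `k`-subsets. -/
def IsMaximalWeaklySeparated {k n : ℕ} (C : Set (KSubset k n)) : Prop :=
  Maximal (fun D : Set (KSubset k n) => ∀ I ∈ D, ∀ J ∈ D, WeaklySeparated I.1 J.1) C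

/-- The Grassmannian of `k`-dimensional subspaces of `ℂⁿ`. -/
abbrev Grassmannian (k n : ℕ) : Type :=
  {p : Submodule ℂ (Fin n → ℂ) // Module.finrank ℂ p = k}

/-- The `k × n` matrix `M` represents `p`: its rows span `p`. -/
def Represents {k n : ℕ} (M : Matrix (Fin k) (Fin n) ℂ) (p : Grassmannian k n) : Prop :=
  Submodule.span ℂ (Set.range M.row) = p.1

/-- The Plücker coordinate `Δ^I` of a `k × n` matrix: the maximal minor on the columns indexed by
`I`, taken in increasing order. -/
noncomputable def plucker {k n : ℕ} (M : Matrix (Fin k) (Fin n) ℂ) (I : KSubset k n) : ℂ :=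
  (M.submatrix id (I.1.orderEmbOfFin I.2)).det

/-- The complex number `z` is real and positive. -/
def IsPosReal (z : ℂ) : Prop := z.im = 0 ∧ 0 < z.re

/-- The point `p` is positive: some representing matrix has all its Plücker coordinates real and
positive. -/
def IsPositive {k n : ℕ} (p : Grassmannian k n) : Prop :=
  ∃ M : Matrix (Fin k) (Fin n) ℂ, Represents M p ∧ ∀ I : KSubset k n, IsPosReal (plucker M I)

/-- The Plücker coordinates of `p` indexed by `C` are real and positive. Plücker coordinates of a
point are defined up to a common nonzero factor, so this means: for some representing matrix. -/
def IsPositiveOn {k n : ℕ} (C : Set (KSubset k n)) (p : Grassmannian k n) : Prop :=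
  ∃ M : Matrix (Fin k) (Fin n) ℂ, Represents M p ∧ ∀ I ∈ C, IsPosReal (plucker M I)

/-- `C` is a positivity test for the Grassmannian. -/
def IsPositivityTest {k n : ℕ} (C : Set (KSubset k n)) : Prop :=
  ∀ p : Grassmannian k n, IsPositive p ↔ IsPositiveOn C p

end GrassmannPositivity

/-! For subsets of equal size, weak separation says that no two elements of `I \ J` alternate with
two elements of `J \ I`. With columns in increasing order, the three-term Plücker relations read xy
= st + uv; if s, t, u, v are positive reals, then x is one exactly when y is. So the subsets with
positive minor form an exchange-closed family, and the claim becomes combinatorial: an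
exchange-closed family containing a maximal noncrossing family contains everything (`all_pairs_mem`,
`all_triples_mem`).

The proof is by induction, deleting the last point N of {0, …, N}. Members through N form fans;
consecutive members of a fan produce members avoiding N, and exchanges fill in the whole fan. Hence
everything compatible with the members avoiding N is in the closure (`compatible_mem`), in
particular any maximal extension of those members, and induction gives all subsets avoiding N.
Exchanges with cyclic intervals, which lie in every maximal family, recover the subsets through N.

For pairs this is the triangulation of a polygon. For triples the link of N has to be controlled: if
{0, c, N - 1} is a member, every member through N contains 0 or N - 1. Such an ear exists after a
rotation, because some member has a cyclic gap 2 (`exists_gap_two`), and crossing and exchange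
depend only on the cyclic order. -/

namespace GrassmannPositivity

/-! ### Noncrossing triples, exchange and the cyclic shift -/

/-- Two triples `a < b < c` and `x < y < z` cross: two elements of each that are missing from the
other alternate. -/
def Cr (a b c x y z : ℕ) : Prop :=
  (x = a ∧ (y < b ∧ b < z ∧ z < c ∨ b < y ∧ y < c ∧ c < z)) ∨
  (a < x ∧ (x < b ∧ b < z ∧ y ≠ b ∧ (z ≠ c ∨ b < y) ∨
    x < c ∧ c < z ∧ y ≠ c ∧ (x ≠ b ∨ y < c))) ∨
  (x < a ∧ (a < y ∧ y < c ∧ b ≠ y ∧ (c ≠ z ∨ y < b) ∨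
    a < z ∧ z < c ∧ b ≠ z ∧ (a ≠ y ∨ b < z)))

theorem Cr.symm {a b c x y z : ℕ} (hab : a < b) (hbc : b < c) (hxy : x < y) (hyz : y < z)
    (h : Cr a b c x y z) : Cr x y z a b c := by
  unfold Cr at *; omega

/-- Inclusion-maximal families of pairwise noncrossing triples `x < y < z` in `{0, …, n - 1}`. -/
structure MaxTriples (n : ℕ) (D : ℕ → ℕ → ℕ → Prop) : Prop where
  sorted : ∀ {x y z}, D x y z → x < y ∧ y < z ∧ z < n
  nc : ∀ {a b c x y z}, D a b c → D x y z → ¬ Cr a b c x y z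
  max : ∀ {a b c}, a < b → b < c → c < n → (∀ x y z, D x y z → ¬ Cr a b c x y z) → D a b c

/-- The image of a family of triples under the cyclic shift. -/
def rot (n : ℕ) (D : ℕ → ℕ → ℕ → Prop) (x y z : ℕ) : Prop :=
  x < y ∧ y < z ∧ z < n ∧ (z + 1 < n → D (x + 1) (y + 1) (z + 1)) ∧
    (z + 1 = n → D 0 (x + 1) (y + 1))

theorem rot_shift {n : ℕ} {D : ℕ → ℕ → ℕ → Prop} {x y z : ℕ} (hxy : x < y) (hyz : y < z)
    (hz : z + 1 < n) : rot n D x y z ↔ D (x + 1) (y + 1) (z + 1) := by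
  unfold rot
  exact ⟨fun h => h.2.2.2.1 hz, fun h => ⟨hxy, hyz, by omega, fun _ => h, fun _ => by omega⟩⟩

theorem rot_wrap {n : ℕ} {D : ℕ → ℕ → ℕ → Prop} {x y : ℕ} (hxy : x < y) (hy : y + 1 < n) :
    rot n D x y (n - 1) ↔ D 0 (x + 1) (y + 1) := by
  unfold rot
  exact ⟨fun h => h.2.2.2.2 (by omega),
    fun h => ⟨hxy, by omega, by omega, fun _ => by omega, fun _ => h⟩⟩

theorem MaxTriples.shift {n : ℕ} {D : ℕ → ℕ → ℕ → Prop} (h : MaxTriples n D) :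
    MaxTriples n (rot n D) where
  sorted := fun h => ⟨h.1, h.2.1, h.2.2.1⟩
  nc := by
    rintro a b c x y z ⟨h1, h2, h3, h4, h5⟩ ⟨k1, k2, k3, k4, k5⟩ hc
    by_cases hcn : c + 1 < n <;> by_cases hzn : z + 1 < n
    · exact h.nc (h4 hcn) (k4 hzn) (by unfold Cr at *; omega)
    · exact h.nc (h4 hcn) (k5 (by omega)) (by unfold Cr at *; omega)
    · exact h.nc (h5 (by omega)) (k4 hzn) (by unfold Cr at *; omega)
    · exact h.nc (h5 (by omega)) (k5 (by omega)) (by unfold Cr at *; omega)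
  max := by
    intro a b c hab hbc hc hm
    have key : ∀ x y z, D x y z → ∃ x' y' z', rot n D x' y' z' ∧
        ((x = 0 ∧ z' = n - 1 ∧ y = x' + 1 ∧ z = y' + 1) ∨
          (x = x' + 1 ∧ y = y' + 1 ∧ z = z' + 1)) := by
      intro x y z hD
      obtain ⟨h1, h2, h3⟩ := h.sorted hD
      rcases x with _ | x
      · refine ⟨y - 1, z - 1, n - 1, (rot_wrap (by omega) (by omega)).2 ?_, by omega⟩
        rwa [Nat.sub_add_cancel (by omega), Nat.sub_add_cancel (by omega)]
      · refine ⟨x, y - 1, z - 1, (rot_shift (by omega) (by omega) (by omega)).2 ?_, by omega⟩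
        rwa [Nat.sub_add_cancel (by omega), Nat.sub_add_cancel (by omega)]
    refine ⟨hab, hbc, hc, fun hcn => ?_, fun hcn => ?_⟩
    · refine h.max (by omega) (by omega) hcn fun x y z hD hcr => ?_
      obtain ⟨x', y', z', hr, hh⟩ := key x y z hD
      have := h.sorted hD
      exact hm _ _ _ hr (by unfold Cr at *; omega)
    · refine h.max (by omega) (by omega) (by omega) fun x y z hD hcr => ?_
      obtain ⟨x', y', z', hr, hh⟩ := key x y z hD
      have := h.sorted hD
      exact hm _ _ _ hr (by unfold Cr at *; omega)

/-- Triples in `{0, …, n - 1}` form a family closed under the three-term exchange. -/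
structure ExClosed (n : ℕ) (P : ℕ → ℕ → ℕ → Prop) : Prop where
  r1 : ∀ {a b c d e}, a < b → b < c → c < d → d < e → e < n →
    P a b c → P a c d → P a d e → P a b e → (P a b d ↔ P a c e)
  r2 : ∀ {a b c d e}, a < b → b < c → c < d → d < e → e < n →
    P a b c → P b c d → P b d e → P a b e → (P a b d ↔ P b c e)
  r3 : ∀ {a b c d e}, a < b → b < c → c < d → d < e → e < n →
    P a b c → P b c d → P c d e → P a c e → (P a c d ↔ P b c e)
  r4 : ∀ {a b c d e}, a < b → b < c → c < d → d < e → e < n →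
    P a b d → P b c d → P c d e → P a d e → (P a c d ↔ P b d e)
  r5 : ∀ {a b c d e}, a < b → b < c → c < d → d < e → e < n →
    P a b e → P b c e → P c d e → P a d e → (P a c e ↔ P b d e)

/-- The five rules are indexed by the position of the common element; when the largest point wraps
to 0, each rule becomes the next one and `r5` becomes `r1`. -/
theorem ExClosed.shift {n : ℕ} {P : ℕ → ℕ → ℕ → Prop} (h : ExClosed n P) : ExClosed n (rot n P) := by
  constructor <;> intro a b c d e hab hbc hcd hde he <;> by_cases hen : e + 1 < n
  · simp (disch := omega) only [rot_shift]
    exact h.r1 (by omega) (by omega) (by omega) (by omega) hen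
  · obtain rfl : e = n - 1 := by omega
    simp (disch := omega) only [rot_shift, rot_wrap]
    intro h1 h2 h3 h4
    exact (h.r2 (a := 0) (b := a + 1) (c := b + 1) (d := c + 1) (e := d + 1) (by omega) (by omega)
      (by omega) (by omega) (by omega) h4 h1 h2 h3).symm
  · simp (disch := omega) only [rot_shift]
    exact h.r2 (by omega) (by omega) (by omega) (by omega) hen
  · obtain rfl : e = n - 1 := by omega
    simp (disch := omega) only [rot_shift, rot_wrap]
    intro h1 h2 h3 h4
    exact (h.r3 (a := 0) (b := a + 1) (c := b + 1) (d := c + 1) (e := d + 1) (by omega) (by omega)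
      (by omega) (by omega) (by omega) h4 h1 h2 h3).symm
  · simp (disch := omega) only [rot_shift]
    exact h.r3 (by omega) (by omega) (by omega) (by omega) hen
  · obtain rfl : e = n - 1 := by omega
    simp (disch := omega) only [rot_shift, rot_wrap]
    intro h1 h2 h3 h4
    exact (h.r4 (a := 0) (b := a + 1) (c := b + 1) (d := c + 1) (e := d + 1) (by omega) (by omega)
      (by omega) (by omega) (by omega) h4 h1 h2 h3).symm
  · simp (disch := omega) only [rot_shift]
    exact h.r4 (by omega) (by omega) (by omega) (by omega) hen
  · obtain rfl : e = n - 1 := by omega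
    simp (disch := omega) only [rot_shift, rot_wrap]
    intro h1 h2 h3 h4
    exact (h.r5 (a := 0) (b := a + 1) (c := b + 1) (d := c + 1) (e := d + 1) (by omega) (by omega)
      (by omega) (by omega) (by omega) h4 h1 h2 h3).symm
  · simp (disch := omega) only [rot_shift]
    exact h.r5 (by omega) (by omega) (by omega) (by omega) hen
  · obtain rfl : e = n - 1 := by omega
    simp (disch := omega) only [rot_wrap]
    intro h1 h2 h3 h4
    exact (h.r1 (a := 0) (b := a + 1) (c := b + 1) (d := c + 1) (e := d + 1) (by omega) (by omega)
      (by omega) (by omega) (by omega) h1 h2 h3 h4)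

theorem all_of_rot {n : ℕ} {P : ℕ → ℕ → ℕ → Prop}
    (h : ∀ x y z, x < y → y < z → z < n → rot n P x y z) :
    ∀ x y z, x < y → y < z → z < n → P x y z := by
  intro x y z hxy hyz hz
  rcases x with _ | x
  · have := (rot_wrap (by omega) (by omega)).1
      (h (y - 1) (z - 1) (n - 1) (by omega) (by omega) (by omega))
    rwa [Nat.sub_add_cancel (by omega), Nat.sub_add_cancel (by omega)] at this
  · have := (rot_shift (by omega) (by omega) (by omega)).1
      (h x (y - 1) (z - 1) (by omega) (by omega) (by omega))
    rwa [Nat.sub_add_cancel (by omega), Nat.sub_add_cancel (by omega)] at this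

theorem rot_mono {n : ℕ} {D P : ℕ → ℕ → ℕ → Prop} (h : ∀ x y z, D x y z → P x y z) :
    ∀ x y z, rot n D x y z → rot n P x y z := by
  rintro x y z ⟨h1, h2, h3, h4, h5⟩
  exact ⟨h1, h2, h3, fun hh => h _ _ _ (h4 hh), fun hh => h _ _ _ (h5 hh)⟩

/-! ### Cyclic gaps and the existence of an ear -/

theorem MaxTriples.iterate {n : ℕ} {D : ℕ → ℕ → ℕ → Prop} (h : MaxTriples n D) (r : ℕ) :
    MaxTriples n ((rot n)^[r] D) := by
  induction r with
  | zero => exact h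
  | succ r ih => rw [Function.iterate_succ_apply']; exact ih.shift

theorem exists_iterate_first_gap {n : ℕ} {D : ℕ → ℕ → ℕ → Prop} {x y z : ℕ} (hxy : x < y)
    (hyz : y < z) (hz : z < n) (hD : D x y z) : ∃ r, (rot n)^[r] D 0 (y - x) (z - x) := by
  induction x generalizing D y z with
  | zero => exact ⟨0, hD⟩
  | succ x ih =>
    obtain ⟨y, rfl⟩ : ∃ y', y = y' + 1 := ⟨y - 1, by omega⟩
    obtain ⟨z, rfl⟩ : ∃ z', z = z' + 1 := ⟨z - 1, by omega⟩
    obtain ⟨r, hr⟩ := ih (by omega) (by omega) (by omega)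
      ((rot_shift (by omega) (by omega) hz).2 hD)
    refine ⟨r + 1, ?_⟩
    rw [Function.iterate_succ_apply]
    simpa using hr

theorem exists_iterate_next_gap {n : ℕ} {D : ℕ → ℕ → ℕ → Prop} {p q : ℕ} (hp : 0 < p)
    (hpq : p < q) (hq : q < n) (h : ∃ r, (rot n)^[r] D 0 p q) :
    ∃ r, (rot n)^[r] D 0 (q - p) (n - p) := by
  obtain ⟨r, hr⟩ := h
  obtain ⟨p, rfl⟩ : ∃ p', p = p' + 1 := ⟨p - 1, by omega⟩
  obtain ⟨q, rfl⟩ : ∃ q', q = q' + 1 := ⟨q - 1, by omega⟩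
  obtain ⟨s, hs⟩ := exists_iterate_first_gap (n := n) (by omega) (by omega) (by omega)
    ((rot_wrap (by omega) hq).2 hr)
  refine ⟨s + (r + 1), ?_⟩
  rw [Function.iterate_add_apply, Function.iterate_succ_apply' _ r]
  rwa [show q + 1 - (p + 1) = q - p by omega, show n - (p + 1) = n - 1 - p by omega]

/-- Every cyclic gap of a member of `D` occurs as the first gap of a member of a rotation. -/
theorem exists_iterate_gaps {n : ℕ} {D : ℕ → ℕ → ℕ → Prop} (h : MaxTriples n D) {x y z : ℕ}
    (hD : D x y z) :
    (∃ r c, c < n ∧ (rot n)^[r] D 0 (y - x) c) ∧ (∃ r c, c < n ∧ (rot n)^[r] D 0 (z - y) c) ∧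
      ∃ r c, c < n ∧ (rot n)^[r] D 0 (n - z + x) c := by
  obtain ⟨hxy, hyz, hz⟩ := h.sorted hD
  have h1 := exists_iterate_first_gap hxy hyz hz hD
  have h2 := exists_iterate_next_gap (by omega) (by omega) (by omega) h1
  have h3 := exists_iterate_next_gap (by omega) (by omega) (by omega) h2
  rw [show z - x - (y - x) = z - y by omega] at h2 h3
  rw [show n - (y - x) - (z - y) = n - z + x by omega] at h3
  obtain ⟨r, h1⟩ := h1
  obtain ⟨s, h2⟩ := h2
  obtain ⟨t, h3⟩ := h3
  exact ⟨⟨r, _, by omega, h1⟩, ⟨s, _, by omega, h2⟩, ⟨t, _, by omega, h3⟩⟩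

/-- A triple without elements in [2, g] crosses {0, 2, c} and {0, g, c} alike. The gap bounds leave
little room in [2, g], and `hlast` excludes {0, g, z} with c < z. -/
theorem Cr.of_long_gap {g c x y z : ℕ} (hg : 3 ≤ g) (hgc : g < c) (hxy : x < y)
    (hyz : y < z) (hnc : ¬ Cr 0 g c x y z)
    (h1 : y - x < 2 ∨ g ≤ y - x) (h2 : z - y < 2 ∨ g ≤ z - y)
    (hlast : x = 0 → y = g → z ≤ c) (h : Cr 0 2 c x y z) : x = g ∧ c < y := by
  unfold Cr at *; omega

theorem Cr.of_long_gap' {n g c x y z : ℕ} (hg : 3 ≤ g) (hgc : g < c) (hc : c < n) (hxy : x < y)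
    (hyz : y < z) (hz : z < n) (hnc : ¬ Cr 0 g c x y z)
    (h1 : y - x < 2 ∨ g ≤ y - x) (h2 : z - y < 2 ∨ g ≤ z - y) (h3 : n - z + x < 2 ∨ g ≤ n - z + x)
    (hfirst : x = 0 → y = g → c ≤ z) (h : Cr (g - 2) g c x y z) : x = 0 ∧ g < y ∧ z < c := by
  unfold Cr at *; omega

/-- A shortest gap g ≥ 2 longer than 2 could be shortened at either end; the members obstructing the
two shortenings cross each other. -/
theorem exists_gap_two {n : ℕ} (hn : 5 ≤ n) {D : ℕ → ℕ → ℕ → Prop} (h : MaxTriples n D) :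
    ∃ r c, (rot n)^[r] D 0 2 c := by
  classical
  -- The bound g ≤ n - 3 discards the long gap n - 2 of a cyclic interval; every other triple has a
  -- gap in this range.
  have hex : ∃ g, 2 ≤ g ∧ g + 3 ≤ n ∧ ∃ r c, c < n ∧ (rot n)^[r] D 0 g c := by
    by_contra! hcon
    have hgap : ∀ x y z, D x y z → (y - x < 2 ∨ n < y - x + 3) ∧ (z - y < 2 ∨ n < z - y + 3) ∧
        (n - z + x < 2 ∨ n < n - z + x + 3) := by
      intro x y z hD
      obtain ⟨⟨r1, c1, h1, k1⟩, ⟨r2, c2, h2, k2⟩, ⟨r3, c3, h3, k3⟩⟩ := exists_iterate_gaps h hD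
      refine ⟨?_, ?_, ?_⟩ <;> by_contra hh
      · exact hcon _ (by omega) (by omega) r1 c1 h1 k1
      · exact hcon _ (by omega) (by omega) r2 c2 h2 k2
      · exact hcon _ (by omega) (by omega) r3 c3 h3 k3
    -- If only cyclic intervals occurred, {0, 1, 3} would cross no member, yet its gap 2 is in the
    -- excluded range.
    have : D 0 1 3 := by
      refine h.max (by omega) (by omega) (by omega) fun x y z hD hc => ?_
      have := hgap _ _ _ hD
      have := h.sorted hD
      unfold Cr at hc; omega
    have := hgap _ _ _ this
    omega
  obtain ⟨h2, hgn, r, c, hc, hD⟩ := Nat.find_spec hex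
  set g := Nat.find hex with hgdef
  have hmin : ∀ m < g, 2 ≤ m → ∀ r c, c < n → ¬ (rot n)^[r] D 0 m c := fun m hm hm2 r c hc hD =>
    Nat.find_min hex hm ⟨hm2, by omega, r, c, hc, hD⟩
  rcases Nat.lt_or_ge 2 g with hg | hg
  swap
  · exact ⟨r, c, (show g = 2 by omega) ▸ hD⟩
  exfalso
  have hE := h.iterate r
  generalize hEdef : (rot n)^[r] D = E at hD hE
  have hgap : ∀ x y z, E x y z → (y - x < 2 ∨ g ≤ y - x) ∧ (z - y < 2 ∨ g ≤ z - y) ∧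
      (n - z + x < 2 ∨ g ≤ n - z + x) := by
    intro x y z hxyz
    obtain ⟨⟨r1, c1, h1, k1⟩, ⟨r2, c2, h2, k2⟩, ⟨r3, c3, h3, k3⟩⟩ := exists_iterate_gaps hE hxyz
    rw [← hEdef, ← Function.iterate_add_apply] at k1 k2 k3
    refine ⟨?_, ?_, ?_⟩ <;> by_contra hh
    · exact hmin _ (by omega) (by omega) _ c1 h1 k1
    · exact hmin _ (by omega) (by omega) _ c2 h2 k2
    · exact hmin _ (by omega) (by omega) _ c3 h3 k3
  obtain ⟨cl, hcl, hlast⟩ : ∃ c, E 0 g c ∧ ∀ z, E 0 g z → z ≤ c :=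
    ⟨Nat.findGreatest (E 0 g) n, Nat.findGreatest_spec hc.le hD,
      fun z hz => Nat.le_findGreatest (hE.sorted hz).2.2.le hz⟩
  obtain ⟨cf, hcf, hfirst⟩ : ∃ c, E 0 g c ∧ ∀ z, E 0 g z → c ≤ z :=
    ⟨Nat.find ⟨c, hD⟩, Nat.find_spec ⟨c, hD⟩, fun z hz => Nat.find_min' _ hz⟩
  have hcl' := hE.sorted hcl
  have hcf' := hE.sorted hcf
  -- Having a gap 2 < g, neither {0, 2, cl} nor {g - 2, g, cf} is a member, so each crosses one.
  have e1 : ∃ x y z, E x y z ∧ Cr 0 2 cl x y z := by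
    by_contra! hcon
    have := hgap _ _ _ (hE.max (by omega) (by omega) (by omega) hcon)
    omega
  have e2 : ∃ x y z, E x y z ∧ Cr (g - 2) g cf x y z := by
    by_contra! hcon
    have := hgap _ _ _ (hE.max (by omega) (by omega) (by omega) hcon)
    omega
  obtain ⟨x, y, z, hW, hcr⟩ := e1
  obtain ⟨x', y', z', hW', hcr'⟩ := e2
  have s1 := hE.sorted hW
  have s2 := hE.sorted hW'
  have g1 := hgap _ _ _ hW
  have g2 := hgap _ _ _ hW'
  have := hcr.of_long_gap hg hcl'.2.1 s1.1 s1.2.1 (hE.nc hcl hW) g1.1 g1.2.1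
    (fun h0 h1 => hlast _ (by rw [h0, h1] at hW; exact hW))
  have := hcr'.of_long_gap' hg hcf'.2.1 hcf'.2.2 s2.1 s2.2.1 s2.2.2 (hE.nc hcf hW') g2.1 g2.2.1
    g2.2.2 (fun h0 h1 => hfirst _ (by rw [h0, h1] at hW'; exact hW'))
  have := hlast _ hcf
  -- The obstructions are {g, y, z} with cl < y and {0, y', z'} with g < y' < z' < cf ≤ cl, so 0 < g
  -- < y' < y alternate.
  refine hE.nc hW hW' ?_
  unfold Cr; omega

/-- Up to rotation, the last element `N` of `{0, …, N}` lies inside a short gap of a member. -/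
theorem exists_ear {N : ℕ} (hN : 4 ≤ N) {D : ℕ → ℕ → ℕ → Prop} (h : MaxTriples (N + 1) D) :
    ∃ r c, (rot (N + 1))^[r] D 0 c (N - 1) := by
  obtain ⟨r, c, hD⟩ := exists_gap_two (by omega) h
  have := (h.iterate r).sorted hD
  obtain ⟨c, rfl⟩ : ∃ c', c = c' + 2 := ⟨c - 2, by omega⟩
  have h1 := (rot_wrap (n := N + 1) (x := 1) (y := c + 1) (by omega) (by omega)).2 hD
  rw [show N + 1 - 1 = (N - 1) + 1 by omega] at h1
  have h2 := (rot_shift (n := N + 1) (x := 0) (y := c) (z := N - 1) (by omega) (by omega)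
    (by omega)).2 h1
  refine ⟨r + 1 + 1, c, ?_⟩
  rwa [Function.iterate_succ_apply', Function.iterate_succ_apply']

/-! ### Triples through the last point: the two fans -/

/-- The neighbours of `y` in a set of integers that has elements on both sides of `y`. -/
theorem exists_neighbours {S : ℕ → Prop} {lo y hi : ℕ} (hlo : S lo) (h1 : lo < y) (h2 : y < hi)
    (hhi : S hi) : ∃ a b, S a ∧ S b ∧ a < y ∧ y < b ∧ b ≤ hi ∧ ∀ m, a < m → m < b → S m → m = y := by
  classical
  have hex : ∃ b, y < b ∧ S b := ⟨hi, h2, hhi⟩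
  refine ⟨Nat.findGreatest S (y - 1), Nat.find hex, Nat.findGreatest_spec (m := lo) (by omega) hlo,
    (Nat.find_spec hex).2, ?_, (Nat.find_spec hex).1, Nat.find_min' hex ⟨h2, hhi⟩, ?_⟩
  · have := Nat.findGreatest_le (P := S) (y - 1)
    omega
  · intro m hm1 hm2 hm
    by_contra hne
    rcases Nat.lt_or_ge y m with h | h
    · exact Nat.find_min hex hm2 ⟨h, hm⟩
    · have := Nat.le_findGreatest (P := S) (n := y - 1) (by omega) hm
      omega

theorem MaxTriples.interval {n : ℕ} {D : ℕ → ℕ → ℕ → Prop} (h : MaxTriples n D) {i : ℕ}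
    (hi : i + 2 < n) : D i (i + 1) (i + 2) := by
  refine h.max (by omega) (by omega) hi fun x y z hD hc => ?_
  have := h.sorted hD
  unfold Cr at hc; omega

theorem MaxTriples.interval_wrap {N : ℕ} {D : ℕ → ℕ → ℕ → Prop} (h : MaxTriples (N + 1) D)
    (hN : 2 ≤ N) : D 0 1 N := by
  refine h.max (by omega) (by omega) (by omega) fun x y z hD hc => ?_
  have := h.sorted hD
  unfold Cr at hc; omega

theorem MaxTriples.interval_wrap' {N : ℕ} {D : ℕ → ℕ → ℕ → Prop} (h : MaxTriples (N + 1) D)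
    (hN : 2 ≤ N) : D 0 (N - 1) N := by
  refine h.max (by omega) (by omega) (by omega) fun x y z hD hc => ?_
  have := h.sorted hD
  unfold Cr at hc; omega

section Ear

variable {N c : ℕ} {D P : ℕ → ℕ → ℕ → Prop}

theorem MaxTriples.link_last (h : MaxTriples (N + 1) D) (hc : D 0 c (N - 1)) {x y : ℕ}
    (hD : D x y N) : (x = 0 ∧ (y ≤ c ∨ y = N - 1)) ∨ (y = N - 1 ∧ c ≤ x) := by
  have h1 := h.sorted hc
  have h2 := h.sorted hD
  have := h.nc hc hD
  unfold Cr at this; omega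

/-- A member avoiding N that crosses {0, q, q'} also crosses {0, q, N} or {0, q', N}. One through N
must, by `link_last`, be a fan member strictly between q and q'. -/
theorem MaxTriples.left_fan_step (h : MaxTriples (N + 1) D) (hc : D 0 c (N - 1)) {q q' : ℕ}
    (hq : D 0 q N) (hq' : D 0 q' N) (hlt : q < q') (hno : ∀ m, q < m → m < q' → ¬ D 0 m N) :
    D 0 q q' := by
  have h1 := h.sorted hq
  have h2 := h.sorted hq'
  have l2 := h.link_last hc hq'
  refine h.max (by omega) hlt (by omega) fun x y z hD hcr => ?_
  have h3 := h.sorted hD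
  rcases Nat.lt_or_ge z N with hz | hz
  · have n1 := h.nc hq hD
    have n2 := h.nc hq' hD
    unfold Cr at *; omega
  · obtain rfl : z = N := by omega
    have l3 := h.link_last hc hD
    have hc' := h.sorted hc
    rcases Nat.eq_zero_or_pos x with rfl | hx
    · exact hno y (by unfold Cr at hcr; omega) (by unfold Cr at hcr; omega) hD
    · have l1 := h.link_last hc hq
      unfold Cr at hcr; omega

theorem MaxTriples.right_fan_step (h : MaxTriples (N + 1) D) (hc : D 0 c (N - 1)) {r r' : ℕ}
    (hr : D r (N - 1) N) (hr' : D r' (N - 1) N) (hlt : r < r')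
    (hno : ∀ m, r < m → m < r' → ¬ D m (N - 1) N) : D r r' (N - 1) := by
  have h1 := h.sorted hr
  have h2 := h.sorted hr'
  have l2 := h.link_last hc hr'
  refine h.max hlt (by omega) (by omega) fun x y z hD hcr => ?_
  have h3 := h.sorted hD
  rcases Nat.lt_or_ge z N with hz | hz
  · have n1 := h.nc hr hD
    have n2 := h.nc hr' hD
    unfold Cr at *; omega
  · obtain rfl : z = N := by omega
    have l3 := h.link_last hc hD
    have hc' := h.sorted hc
    by_cases hy : y = z - 1
    · subst hy
      exact hno x (by unfold Cr at hcr; omega) (by unfold Cr at hcr; omega) hD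
    · have l1 := h.link_last hc hr
      unfold Cr at hcr; omega

theorem MaxTriples.left_fan (h : MaxTriples (N + 1) D) (hc : D 0 c (N - 1))
    (hP : ExClosed (N + 1) P) (hDP : ∀ x y z, D x y z → P x y z) (k : ℕ) :
    ∀ q q', q' - q ≤ k → q < q' → D 0 q N → D 0 q' N → P 0 q q' := by
  induction k with
  | zero => intro q q' h1 h2; omega
  | succ k ih =>
    intro q q' hk hlt hq hq'
    by_cases hno : ∀ m, q < m → m < q' → ¬ D 0 m N
    · exact hDP _ _ _ (h.left_fan_step hc hq hq' hlt hno)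
    · push Not at hno
      obtain ⟨m, h1, h2, hm⟩ := hno
      have s1 := h.sorted hq
      have s2 := h.sorted hq'
      -- Exchange with common element 0 on q < m < q' < N: the diagonals are {0, q, q'} and {0, m,
      -- N}.
      exact (hP.r1 s1.1 h1 h2 s2.2.1 s2.2.2 (ih q m (by omega) h1 hq hm)
        (ih m q' (by omega) h2 hm hq') (hDP _ _ _ hq') (hDP _ _ _ hq)).2 (hDP _ _ _ hm)

theorem MaxTriples.right_fan (h : MaxTriples (N + 1) D) (hc : D 0 c (N - 1))
    (hP : ExClosed (N + 1) P) (hDP : ∀ x y z, D x y z → P x y z) (k : ℕ) :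
    ∀ r r', r' - r ≤ k → r < r' → D r (N - 1) N → D r' (N - 1) N → P r r' (N - 1) := by
  induction k with
  | zero => intro q q' h1 h2; omega
  | succ k ih =>
    intro r r' hk hlt hr hr'
    by_cases hno : ∀ m, r < m → m < r' → ¬ D m (N - 1) N
    · exact hDP _ _ _ (h.right_fan_step hc hr hr' hlt hno)
    · push Not at hno
      obtain ⟨m, h1, h2, hm⟩ := hno
      have s2 := h.sorted hr'
      exact (hP.r4 h1 h2 s2.1 s2.2.1 s2.2.2 (ih r m (by omega) h1 hr hm)
        (ih m r' (by omega) h2 hm hr') (hDP _ _ _ hr') (hDP _ _ _ hr)).2 (hDP _ _ _ hm)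

theorem Cr.left_shape {q₀ q q₁ x y z : ℕ} (h2 : q < q₁) (hxy : x < y) (hyz : y < z) (hz : z < N) (c1 : ¬ Cr x y z 0 q₀ q)
    (c2 : ¬ Cr x y z 0 q q₁) (hc : Cr x y z 0 q N) : x = 0 ∧ y < q ∧ q < z := by
  unfold Cr at *; omega

theorem Cr.right_shape {r₀ r r₁ x y z : ℕ} (h1 : r₀ < r) (h2 : r < r₁)
    (h3 : r₁ < N - 1) (hxy : x < y) (hyz : y < z) (hz : z < N) (c1 : ¬ Cr x y z r₀ r (N - 1))
    (c2 : ¬ Cr x y z r r₁ (N - 1)) (hc : Cr x y z r (N - 1) N) : z = N - 1 ∧ x < r ∧ r < y := by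
  unfold Cr at *; omega

/-- If y were missing from the fan, its fan neighbours a < y < b ≤ q would give a member {0, a, b}
crossing {0, y, z}; similarly for z. -/
theorem MaxTriples.mem_of_left_shape (h : MaxTriples (N + 1) D) (hc : D 0 c (N - 1))
    {q y z : ℕ} (hq : D 0 q N) (hy : 0 < y) (hyq : y < q) (hqz : q < z) (hz : z < N)
    (hnc : ∀ a b d, D a b d → d < N → ¬ Cr 0 y z a b d) : D 0 y N ∧ D 0 z N := by
  have h1 := h.interval_wrap (by omega)
  have h2 := h.interval_wrap' (by omega)
  constructor <;> by_contra hcon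
  · obtain ⟨a, b, ha, hb, hay, hyb, hbq, hno⟩ := exists_neighbours (S := fun m => D 0 m N) (y := y)
      h1 (by by_contra hh; exact hcon ((show y = 1 by omega) ▸ h1)) hyq hq
    refine hnc 0 a b (h.left_fan_step hc ha hb (by omega) fun m m1 m2 hm =>
      hcon (hno m m1 m2 hm ▸ hm)) (by omega) ?_
    unfold Cr; omega
  · have hzN : z < N - 1 := by
      by_contra hh; exact hcon ((show z = N - 1 by omega) ▸ h2)
    obtain ⟨b, a, hb, ha, hbz, hza, haN, hno⟩ := exists_neighbours (S := fun m => D 0 m N) (y := z)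
      hq hqz hzN h2
    have hqb : q ≤ b := by
      by_contra hh
      have := hno q (by omega) (by omega) hq
      omega
    refine hnc 0 b a (h.left_fan_step hc hb ha (by omega) fun m m1 m2 hm =>
      hcon (hno m m1 m2 hm ▸ hm)) (by omega) ?_
    unfold Cr; omega

theorem MaxTriples.mem_of_right_shape (h : MaxTriples (N + 1) D) (hc : D 0 c (N - 1))
    {r x y : ℕ} (hr : D r (N - 1) N) (hxr : x < r) (hry : r < y) (hy : y < N - 1)
    (hnc : ∀ a b d, D a b d → d < N → ¬ Cr x y (N - 1) a b d) :
    D x (N - 1) N ∧ D y (N - 1) N := by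
  have h1 := h.interval_wrap' (by omega)
  have h2 : D (N - 2) (N - 1) N := by
    have := h.interval (i := N - 2) (by omega)
    rwa [show N - 2 + 1 = N - 1 by omega, show N - 2 + 2 = N by omega] at this
  constructor <;> by_contra hcon
  · have hx : 0 < x := by
      by_contra hh; exact hcon ((show x = 0 by omega) ▸ h1)
    obtain ⟨a, b, ha, hb, hax, hxb, hbr, hno⟩ := exists_neighbours
      (S := fun m => D m (N - 1) N) (y := x) h1 hx hxr hr
    refine hnc a b (N - 1) (h.right_fan_step hc ha hb (by omega) fun m m1 m2 hm =>
      hcon (hno m m1 m2 hm ▸ hm)) (by omega) ?_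
    unfold Cr; omega
  · have hyN : y < N - 2 := by
      by_contra hh; exact hcon ((show y = N - 2 by omega) ▸ h2)
    obtain ⟨b, a, hb, ha, hby, hya, haN, hno⟩ := exists_neighbours
      (S := fun m => D m (N - 1) N) (y := y) hr hry hyN h2
    have hrb : r ≤ b := by
      by_contra hh
      have := hno r (by omega) (by omega) hr
      omega
    refine hnc b a (N - 1) (h.right_fan_step hc hb ha (by omega) fun m m1 m2 hm =>
      hcon (hno m m1 m2 hm ▸ hm)) (by omega) ?_
    unfold Cr; omega

/-- Deleting the last element: every triple compatible with the members of `D` that avoid `N`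
lies in the exchange closure of `D`. -/
theorem MaxTriples.compatible_mem (h : MaxTriples (N + 1) D) (hc : D 0 c (N - 1))
    (hP : ExClosed (N + 1) P) (hDP : ∀ x y z, D x y z → P x y z) {x y z : ℕ} (hxy : x < y)
    (hyz : y < z) (hz : z < N) (hnc : ∀ a b d, D a b d → d < N → ¬ Cr x y z a b d) : P x y z := by
  by_cases hall : ∀ a b d, D a b d → ¬ Cr x y z a b d
  · exact hDP _ _ _ (h.max hxy hyz (by omega) hall)
  push Not at hall
  obtain ⟨a, b, d, hD, hcr⟩ := hall
  have hs := h.sorted hD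
  obtain rfl : d = N := by
    by_contra hne
    exact hnc a b d hD (by omega) hcr
  have hcs := h.sorted hc
  have i1 := h.interval_wrap (by omega)
  have i2 := h.interval_wrap' (by omega)
  -- The cyclic interval {0, N - 1, N} crosses nothing, so exactly one fan is involved.
  have hor : (a = 0 ∧ b < d - 1) ∨ (b = d - 1 ∧ 0 < a) := by
    have := h.link_last hc hD
    unfold Cr at hcr; omega
  rcases hor with ⟨rfl, hb⟩ | ⟨rfl, ha⟩
  · obtain ⟨q₀, q₁, hq₀, hq₁, l1, l2, l3, hno⟩ := exists_neighbours (S := fun m => D 0 m d) (y := b)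
      i1 (by unfold Cr at hcr; omega) hb i2
    have d1 := h.left_fan_step hc hq₀ hD l1 fun m m1 m2 hm => by
      have := hno m m1 (by omega) hm; omega
    have d2 := h.left_fan_step hc hD hq₁ l2 fun m m1 m2 hm => by
      have := hno m (by omega) m2 hm; omega
    obtain ⟨rfl, hyb, hbz⟩ := hcr.left_shape l2 hxy hyz hz
      (hnc _ _ _ d1 (by omega)) (hnc _ _ _ d2 (by omega))
    obtain ⟨hy, hz'⟩ := h.mem_of_left_shape hc hD hxy hyb hbz hz hnc
    exact h.left_fan hc hP hDP _ y z le_rfl hyz hy hz'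
  · have i3 : D (d - 2) (d - 1) d := by
      have := h.interval (i := d - 2) (by omega)
      rwa [show d - 2 + 1 = d - 1 by omega, show d - 2 + 2 = d by omega] at this
    obtain ⟨r₀, r₁, hr₀, hr₁, l1, l2, l3, hno⟩ := exists_neighbours
      (S := fun m => D m (d - 1) d) (y := a) i2 ha (by unfold Cr at hcr; omega) i3
    have d1 := h.right_fan_step hc hr₀ hD l1 fun m m1 m2 hm => by
      have := hno m m1 (by omega) hm; omega
    have d2 := h.right_fan_step hc hD hr₁ l2 fun m m1 m2 hm => by
      have := hno m (by omega) m2 hm; omega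
    obtain ⟨rfl, hxa, hay⟩ := hcr.right_shape l1 l2 (by omega) hxy hyz hz
      (hnc _ _ _ d1 (by omega)) (hnc _ _ _ d2 (by omega))
    obtain ⟨hx, hy⟩ := h.mem_of_right_shape hc hD hxa hay hyz hnc
    exact h.right_fan hc hP hDP _ x y le_rfl hxy hx hy

end Ear

/-! ### Induction on the number of points, for triples -/

theorem exists_maximal_compatible {α : Type*} {V : α → Prop} {R : α → α → Prop}
    (hirr : ∀ p, V p → ¬ R p p) (hsymm : ∀ p q, V p → V q → R p q → R q p) {S : Set α}
    (hS : ∀ p ∈ S, V p) (hR : ∀ p ∈ S, ∀ q ∈ S, ¬ R p q) :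
    ∃ M, S ⊆ M ∧ (∀ p ∈ M, V p) ∧ (∀ p ∈ M, ∀ q ∈ M, ¬ R p q) ∧
      ∀ p, V p → (∀ q ∈ M, ¬ R p q) → p ∈ M := by
  obtain ⟨M, hSM, hM⟩ := zorn_subset_nonempty
    {T : Set α | (∀ p ∈ T, V p) ∧ ∀ p ∈ T, ∀ q ∈ T, ¬ R p q} (by
      intro c hcF hc _
      refine ⟨⋃₀ c, ⟨?_, ?_⟩, fun s hs => Set.subset_sUnion_of_mem hs⟩
      · rintro p ⟨S, hS, hp⟩
        exact (hcF hS).1 p hp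
      · rintro p ⟨S, hS, hp⟩ q ⟨T, hT, hq⟩
        rcases hc.total hS hT with hST | hST
        · exact (hcF hT).2 p (hST hp) q hq
        · exact (hcF hS).2 p hp q (hST hq)) S ⟨hS, hR⟩
  refine ⟨M, hSM, hM.prop.1, hM.prop.2, fun p hp hall => ?_⟩
  refine hM.le_of_ge (y := insert p M) ⟨?_, ?_⟩ (Set.subset_insert _ _) (Set.mem_insert _ _)
  · rintro q (rfl | hq)
    exacts [hp, hM.prop.1 q hq]
  · rintro q (rfl | hq) r (rfl | hr)
    · exact hirr _ hp
    · exact hall _ hr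
    · exact fun h => hall _ hq (hsymm _ _ (hM.prop.1 q hq) hp h)
    · exact hM.prop.2 q hq r hr

theorem exists_maxTriples_extension {n : ℕ} {D : ℕ → ℕ → ℕ → Prop}
    (hs : ∀ x y z, D x y z → x < y ∧ y < z ∧ z < n)
    (hnc : ∀ a b c x y z, D a b c → D x y z → ¬ Cr a b c x y z) :
    ∃ E, MaxTriples n E ∧ ∀ x y z, D x y z → E x y z := by
  obtain ⟨M, hDM, hV, hR, hmax⟩ := exists_maximal_compatible
    (V := fun p : ℕ × ℕ × ℕ => p.1 < p.2.1 ∧ p.2.1 < p.2.2 ∧ p.2.2 < n)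
    (R := fun p q => Cr p.1 p.2.1 p.2.2 q.1 q.2.1 q.2.2) (S := {p | D p.1 p.2.1 p.2.2})
    (fun p _ => by unfold Cr; omega) (fun p q hp hq h => h.symm hp.1 hp.2.1 hq.1 hq.2.1)
    (fun p hp => hs _ _ _ hp) (fun p hp q hq => hnc _ _ _ _ _ _ hp hq)
  exact ⟨fun x y z => (x, y, z) ∈ M, ⟨fun h => hV _ h, fun h h' => hR _ h _ h',
    fun hab hbc hc hall => hmax _ ⟨hab, hbc, hc⟩ fun q hq => hall _ _ _ hq⟩, fun x y z h => hDM h⟩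

/-- Three exchanges reach the triples through N: with common element 0 for {0, j, N}, with N - 1 for
{j, N - 1, N}, then with y for {x, y, N}. -/
theorem ExClosed.extend {N : ℕ} {P : ℕ → ℕ → ℕ → Prop} (hP : ExClosed (N + 1) P)
    (hall : ∀ x y z, x < y → y < z → z < N → P x y z) (h1 : P 0 1 N) (h2 : P 0 (N - 1) N)
    (h3 : P (N - 2) (N - 1) N) : ∀ x y z, x < y → y < z → z < N + 1 → P x y z := by
  have a1 : ∀ j, 0 < j → j < N → P 0 j N := by
    intro j hj hjN
    rcases Nat.lt_or_ge 1 j with hj1 | hj1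
    · rcases Nat.lt_or_ge j (N - 1) with hj2 | hj2
      · exact (hP.r1 (a := 0) (b := 1) (c := j) (d := N - 1) (e := N) (by omega) hj1 hj2
          (by omega) (by omega) (hall _ _ _ (by omega) hj1 (by omega))
          (hall _ _ _ hj hj2 (by omega)) h2 h1).1
          (hall _ _ _ (by omega) (by omega) (by omega))
      · rwa [show j = N - 1 by omega]
    · rwa [show j = 1 by omega]
  have a2 : ∀ j, j < N - 1 → P j (N - 1) N := by
    intro j hj
    rcases Nat.eq_zero_or_pos j with rfl | hj0
    · exact h2
    rcases Nat.lt_or_ge j (N - 2) with hj2 | hj2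
    · exact (hP.r4 (a := 0) (b := j) (c := N - 2) (d := N - 1) (e := N) hj0 hj2 (by omega)
        (by omega) (by omega) (hall _ _ _ hj0 hj (by omega))
        (hall _ _ _ hj2 (by omega) (by omega)) h3 h2).1
        (hall _ _ _ (by omega) (by omega) (by omega))
    · rwa [show j = N - 2 by omega]
  intro x y z hxy hyz hz
  rcases Nat.lt_or_ge z N with hzN | hzN
  · exact hall x y z hxy hyz hzN
  obtain rfl : z = N := by omega
  rcases Nat.eq_zero_or_pos x with rfl | hx
  · exact a1 y hxy hyz
  rcases Nat.lt_or_ge y (z - 1) with hy | hy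
  · exact (hP.r3 (a := 0) (b := x) (c := y) (d := z - 1) (e := z) hx hxy hy (by omega) (by omega)
      (hall _ _ _ hx hxy hyz) (hall _ _ _ hxy hy (by omega)) (a2 y hy)
      (a1 y (by omega) hyz)).1 (hall _ _ _ (by omega) hy (by omega))
  · rw [show y = z - 1 by omega]
    exact a2 x (by omega)

theorem ExClosed.restrict {N : ℕ} {P : ℕ → ℕ → ℕ → Prop} (h : ExClosed (N + 1) P) :
    ExClosed N P where
  r1 h1 h2 h3 h4 h5 := h.r1 h1 h2 h3 h4 (by omega)
  r2 h1 h2 h3 h4 h5 := h.r2 h1 h2 h3 h4 (by omega)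
  r3 h1 h2 h3 h4 h5 := h.r3 h1 h2 h3 h4 (by omega)
  r4 h1 h2 h3 h4 h5 := h.r4 h1 h2 h3 h4 (by omega)
  r5 h1 h2 h3 h4 h5 := h.r5 h1 h2 h3 h4 (by omega)

/-- The exchange closure of a maximal noncrossing family contains all triples. -/
theorem all_triples_mem {n : ℕ} : ∀ {D P : ℕ → ℕ → ℕ → Prop}, MaxTriples n D → ExClosed n P →
    (∀ x y z, D x y z → P x y z) → ∀ x y z, x < y → y < z → z < n → P x y z := by
  induction n with
  | zero => intro D P _ _ _ x y z _ _ hz; omega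
  | succ N ih =>
    intro D P hD hP hDP
    rcases Nat.lt_or_ge N 4 with hN | hN
    · intro x y z hxy hyz hz
      -- On at most four points two triples differ in at most one element, so none cross.
      refine hDP _ _ _ (hD.max hxy hyz hz fun a b c habc hcr => ?_)
      have := hD.sorted habc
      unfold Cr at hcr; omega
    obtain ⟨r, c, hc⟩ := exists_ear hN hD
    have key : ∀ {D P : ℕ → ℕ → ℕ → Prop}, MaxTriples (N + 1) D → ExClosed (N + 1) P →
        (∀ x y z, D x y z → P x y z) → D 0 c (N - 1) →
        ∀ x y z, x < y → y < z → z < N + 1 → P x y z := by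
      intro D P hD hP hDP hc
      obtain ⟨E, hE, hDE⟩ := exists_maxTriples_extension (n := N)
        (D := fun x y z => D x y z ∧ z < N)
        (fun x y z h => ⟨(hD.sorted h.1).1, (hD.sorted h.1).2.1, h.2⟩)
        (fun a b c x y z h h' => hD.nc h.1 h'.1)
      have hEP : ∀ x y z, E x y z → P x y z := by
        intro x y z hxyz
        have hs := hE.sorted hxyz
        exact hD.compatible_mem hc hP hDP hs.1 hs.2.1 hs.2.2
          fun a b d habd hd => hE.nc hxyz (hDE _ _ _ ⟨habd, hd⟩)
      refine hP.extend (ih hE hP.restrict hEP) (hDP _ _ _ (hD.interval_wrap (by omega)))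
        (hDP _ _ _ (hD.interval_wrap' (by omega))) ?_
      have := hD.interval (i := N - 2) (by omega)
      rw [show N - 2 + 1 = N - 1 by omega, show N - 2 + 2 = N by omega] at this
      exact hDP _ _ _ this
    induction r generalizing D P with
    | zero => exact key hD hP hDP hc
    | succ r ihr => exact all_of_rot (ihr hD.shift hP.shift (rot_mono hDP) hc)

/-! ### The case of pairs -/

/-- Two pairs `a < b` and `x < y` alternate. -/
def CrPair (a b x y : ℕ) : Prop := (a < x ∧ x < b ∧ b < y) ∨ (x < a ∧ a < y ∧ y < b)

/-- Inclusion-maximal families of pairwise noncrossing pairs `x < y` in `{0, …, n - 1}`. -/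
structure MaxPairs (n : ℕ) (D : ℕ → ℕ → Prop) : Prop where
  sorted : ∀ {x y}, D x y → x < y ∧ y < n
  nc : ∀ {a b x y}, D a b → D x y → ¬ CrPair a b x y
  max : ∀ {a b}, a < b → b < n → (∀ x y, D x y → ¬ CrPair a b x y) → D a b

/-- Pairs in `{0, …, n - 1}` form a family closed under the three-term exchange. -/
def ExClosedPair (n : ℕ) (P : ℕ → ℕ → Prop) : Prop :=
  ∀ {a b c d}, a < b → b < c → c < d → d < n → P a b → P b c → P c d → P a d → (P a c ↔ P b d)

variable {N : ℕ} {D P : ℕ → ℕ → Prop}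

/-- A member crossing {q, q'} and avoiding N crosses {q, N} or {q', N}. The pairs through N form a
single fan, so no ear is needed. -/
theorem MaxPairs.fan_step (h : MaxPairs (N + 1) D) {q q' : ℕ} (hq : D q N) (hq' : D q' N)
    (hlt : q < q') (hno : ∀ m, q < m → m < q' → ¬ D m N) : D q q' := by
  have h1 := h.sorted hq
  have h2 := h.sorted hq'
  refine h.max hlt (by omega) fun x y hD hcr => ?_
  have h3 := h.sorted hD
  have n1 := h.nc hq hD
  have n2 := h.nc hq' hD
  unfold CrPair at *
  obtain rfl : y = N := by omega
  exact hno x (by omega) (by omega) hD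

theorem MaxPairs.fan (h : MaxPairs (N + 1) D) (hP : ExClosedPair (N + 1) P)
    (hDP : ∀ x y, D x y → P x y) (k : ℕ) :
    ∀ q q', q' - q ≤ k → q < q' → D q N → D q' N → P q q' := by
  induction k with
  | zero => intro q q' h1 h2; omega
  | succ k ih =>
    intro q q' hk hlt hq hq'
    by_cases hno : ∀ m, q < m → m < q' → ¬ D m N
    · exact hDP _ _ (h.fan_step hq hq' hlt hno)
    · push Not at hno
      obtain ⟨m, h1, h2, hm⟩ := hno
      have s2 := h.sorted hq'
      exact (hP h1 h2 s2.1 s2.2 (ih q m (by omega) h1 hq hm) (ih m q' (by omega) h2 hm hq')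
        (hDP _ _ hq') (hDP _ _ hq)).2 (hDP _ _ hm)

theorem MaxPairs.compatible_mem (h : MaxPairs (N + 1) D) (hP : ExClosedPair (N + 1) P)
    (hDP : ∀ x y, D x y → P x y) {x y : ℕ} (hxy : x < y) (hy : y < N)
    (hnc : ∀ a b, D a b → b < N → ¬ CrPair x y a b) : P x y := by
  by_cases hall : ∀ a b, D a b → ¬ CrPair x y a b
  · exact hDP _ _ (h.max hxy (by omega) hall)
  push Not at hall
  obtain ⟨q, b, hq, hcr⟩ := hall
  have hs := h.sorted hq
  obtain rfl : b = N := by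
    by_contra hne
    exact hnc q b hq (by omega) hcr
  have hxq : x < q ∧ q < y := by unfold CrPair at hcr; omega
  have i1 : D 0 b := h.max (by omega) (by omega) fun u v huv hc => by
    have := h.sorted huv
    unfold CrPair at hc; omega
  have i2 : D (b - 1) b := h.max (by omega) (by omega) fun u v huv hc => by
    have := h.sorted huv
    unfold CrPair at hc; omega
  refine h.fan hP hDP _ x y le_rfl hxy ?_ ?_ <;> by_contra hcon
  · have hx : 0 < x := by
      by_contra hh; exact hcon ((show x = 0 by omega) ▸ i1)
    obtain ⟨u, v, hu, hv, h1, h2, h3, hno⟩ := exists_neighbours (S := fun m => D m b) i1 hx hxq.1 hq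
    refine hnc u v (h.fan_step hu hv (by omega) fun m m1 m2 hm => hcon (hno m m1 m2 hm ▸ hm))
      (by omega) ?_
    unfold CrPair; omega
  · have hyb : y < b - 1 := by
      by_contra hh; exact hcon ((show y = b - 1 by omega) ▸ i2)
    obtain ⟨u, v, hu, hv, h1, h2, h3, hno⟩ := exists_neighbours (S := fun m => D m b) hq hxq.2 hyb i2
    have hqu : q ≤ u := by
      by_contra hh
      have := hno q (by omega) (by omega) hq
      omega
    refine hnc u v (h.fan_step hu hv (by omega) fun m m1 m2 hm => hcon (hno m m1 m2 hm ▸ hm))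
      (by omega) ?_
    unfold CrPair; omega

/-- The exchange closure of a maximal noncrossing family contains all pairs. -/
theorem all_pairs_mem {n : ℕ} : ∀ {D P : ℕ → ℕ → Prop}, MaxPairs n D → ExClosedPair n P →
    (∀ x y, D x y → P x y) → ∀ x y, x < y → y < n → P x y := by
  induction n with
  | zero => intro D P _ _ _ x y _ hy; omega
  | succ N ih =>
    intro D P hD hP hDP
    obtain ⟨M, hDM, hV, hR, hmax⟩ := exists_maximal_compatible
      (V := fun p : ℕ × ℕ => p.1 < p.2 ∧ p.2 < N) (R := fun p q => CrPair p.1 p.2 q.1 q.2)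
      (S := {p | D p.1 p.2 ∧ p.2 < N})
      (fun p _ => by unfold CrPair; omega) (fun p q _ _ h => by unfold CrPair at *; omega)
      (fun p hp => ⟨(hD.sorted hp.1).1, hp.2⟩) (fun p hp q hq => hD.nc hp.1 hq.1)
    have hall : ∀ x y, x < y → y < N → P x y := by
      refine ih (D := fun x y => (x, y) ∈ M) ⟨fun h => hV _ h, fun h h' => hR _ h _ h',
        fun hab hb hall => hmax _ ⟨hab, hb⟩ fun q hq => hall _ _ hq⟩
        (fun h1 h2 h3 h4 => hP h1 h2 h3 (by omega)) fun x y hxy => ?_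
      exact hD.compatible_mem hP hDP (hV _ hxy).1 (hV _ hxy).2
        fun a b hab hb => hR (x, y) hxy (a, b) (hDM ⟨hab, hb⟩)
    intro x y hxy hy
    rcases Nat.lt_or_ge y N with hyN | hyN
    · exact hall x y hxy hyN
    obtain rfl : y = N := by omega
    have i1 : P 0 y := hDP _ _ (hD.max (by omega) hy fun u v huv hc => by
      have := hD.sorted huv
      unfold CrPair at hc; omega)
    have i2 : P (y - 1) y := hDP _ _ (hD.max (by omega) hy fun u v huv hc => by
      have := hD.sorted huv
      unfold CrPair at hc; omega)
    rcases Nat.eq_zero_or_pos x with rfl | hx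
    · exact i1
    rcases Nat.lt_or_ge x (y - 1) with hx1 | hx1
    · exact (hP hx hx1 (by omega) hy (hall _ _ hx hxy) (hall _ _ hx1 (by omega)) i2 i1).1
        (hall _ _ (by omega) (by omega))
    · rwa [show x = y - 1 by omega]

/-! ### Weak separation as absence of alternation -/

/-- Two elements of `I \ J` and two elements of `J \ I` alternate. -/
def Alternating {n : ℕ} (I J : Finset (Fin n)) : Prop :=
  ∃ p ∈ I \ J, ∃ q ∈ I \ J, ∃ u ∈ J \ I, ∃ v ∈ J \ I,
    (p < u ∧ u < q ∧ q < v) ∨ (u < p ∧ p < v ∧ v < q)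

theorem Surrounds.not_between {n : ℕ} {I J : Finset (Fin n)} (h : Surrounds I J) {p q u : Fin n}
    (hp : p ∈ I \ J) (hq : q ∈ I \ J) (hu : u ∈ J \ I) (hpu : p < u) (huq : u < q) : False := by
  obtain ⟨-, J', J'', -, hJ, h1, h2⟩ := h
  rw [← hJ, Finset.mem_union] at hu
  rcases hu with hu | hu
  · exact lt_asymm hpu (h1 u hu p hp)
  · exact lt_asymm huq (h2 q hq u hu)

theorem surrounds_of_not_between {n : ℕ} {I J : Finset (Fin n)} (hc : J.card ≤ I.card)
    (h : ∀ p ∈ I \ J, ∀ q ∈ I \ J, ∀ u ∈ J \ I, p < u → ¬ u < q) : Surrounds I J := by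
  classical
  refine ⟨hc, (J \ I).filter (fun u => ∀ p ∈ I \ J, u < p),
    (J \ I).filter (fun u => ¬ ∀ p ∈ I \ J, u < p), Finset.disjoint_filter_filter_not _ _ _,
    Finset.filter_union_filter_not_eq _ _, ?_, ?_⟩
  · intro u hu p hp
    exact (Finset.mem_filter.1 hu).2 p hp
  · intro q hq u hu
    obtain ⟨hu, hex⟩ := Finset.mem_filter.1 hu
    push Not at hex
    obtain ⟨p, hp, hpu⟩ := hex
    have hne : ∀ r ∈ I \ J, r ≠ u := by
      rintro r hr rfl
      exact (Finset.mem_sdiff.1 hr).2 (Finset.mem_sdiff.1 hu).1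
    exact lt_of_le_of_ne (not_lt.1 (h p hp q hq u hu (lt_of_le_of_ne hpu (hne p hp)))) (hne q hq)

/-- Equal sizes make both cardinality conditions automatic. If both surroundings fail, there are p <
u < q and u' < p' < v; comparing p' with u yields an alternation. -/
theorem weaklySeparated_iff {n : ℕ} {I J : Finset (Fin n)} (hc : I.card = J.card) :
    WeaklySeparated I J ↔ ¬ Alternating I J := by
  constructor
  · rintro (h | h) ⟨p, hp, q, hq, u, hu, v, hv, ⟨h1, h2, h3⟩ | ⟨h1, h2, h3⟩⟩
    · exact h.not_between hp hq hu h1 h2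
    · exact h.not_between hp hq hv h2 h3
    · exact h.not_between hu hv hq h2 h3
    · exact h.not_between hu hv hp h1 h2
  · intro h
    by_contra hcon
    simp only [WeaklySeparated, not_or] at hcon
    have h1 := mt (surrounds_of_not_between hc.ge) hcon.1
    have h2 := mt (surrounds_of_not_between hc.le) hcon.2
    push Not at h1 h2
    obtain ⟨p, hp, q, hq, u, hu, hpu, huq⟩ := h1
    obtain ⟨u', hu', v, hv, p', hp', h3, h4⟩ := h2
    have hne : p' ≠ u := by
      rintro rfl
      exact (Finset.mem_sdiff.1 hp').2 (Finset.mem_sdiff.1 hu).1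
    rcases lt_or_gt_of_ne hne with hlt | hlt
    · exact h ⟨p', hp', q, hq, u', hu', u, hu, Or.inr ⟨h3, hlt, huq⟩⟩
    · exact h ⟨p, hp, p', hp', u, hu, v, hv, Or.inl ⟨hpu, hlt, h4⟩⟩

/-- The subset `{x < y < z}`. -/
def triple {n : ℕ} (x y z : ℕ) (h : x < y ∧ y < z ∧ z < n) : KSubset 3 n :=
  ⟨{⟨x, by omega⟩, ⟨y, by omega⟩, ⟨z, by omega⟩}, 
    Finset.card_eq_three.2 ⟨⟨x, by omega⟩, ⟨y, by omega⟩, ⟨z, by omega⟩, by simp; omega,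
      by simp; omega, by simp; omega, rfl⟩⟩

/-- The subset `{x < y}`. -/
def pair {n : ℕ} (x y : ℕ) (h : x < y ∧ y < n) : KSubset 2 n :=
  ⟨{⟨x, by omega⟩, ⟨y, by omega⟩}, 
    Finset.card_eq_two.2 ⟨⟨x, by omega⟩, ⟨y, by omega⟩, by simp; omega, rfl⟩⟩

theorem exists_eq_triple {n : ℕ} (I : KSubset 3 n) : ∃ x y z h, I = triple x y z h := by
  set e := I.1.orderEmbOfFin I.2 with he
  have h : (e 0 : ℕ) < e 1 ∧ (e 1 : ℕ) < e 2 ∧ (e 2 : ℕ) < n :=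
    ⟨e.strictMono (by decide), e.strictMono (by decide), (e 2).2⟩
  refine ⟨_, _, _, h, Subtype.ext ?_⟩
  rw [← Finset.image_orderEmbOfFin_univ I.1 I.2, ← he]
  ext i
  simp [triple, Fin.exists_fin_succ, eq_comm]

theorem exists_eq_pair {n : ℕ} (I : KSubset 2 n) : ∃ x y h, I = pair x y h := by
  set e := I.1.orderEmbOfFin I.2 with he
  have h : (e 0 : ℕ) < e 1 ∧ (e 1 : ℕ) < n := ⟨e.strictMono (by decide), (e 1).2⟩
  refine ⟨_, _, h, Subtype.ext ?_⟩
  rw [← Finset.image_orderEmbOfFin_univ I.1 I.2, ← he]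
  ext i
  simp [pair, Fin.exists_fin_succ, eq_comm]

theorem Cr.of_alternate {a b c x y z p q u v : ℕ} (hab : a < b) (hbc : b < c) (hxy : x < y)
    (hyz : y < z) (hpq : (p = a ∧ q = b) ∨ (p = a ∧ q = c) ∨ (p = b ∧ q = c))
    (huv : (u = x ∧ v = y) ∨ (u = x ∧ v = z) ∨ (u = y ∧ v = z)) (hp : p ≠ x ∧ p ≠ y ∧ p ≠ z)
    (hq : q ≠ x ∧ q ≠ y ∧ q ≠ z) (hu : u ≠ a ∧ u ≠ b ∧ u ≠ c) (hv : v ≠ a ∧ v ≠ b ∧ v ≠ c)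
    (hlt : (p < u ∧ u < q ∧ q < v) ∨ (u < p ∧ p < v ∧ v < q)) : Cr a b c x y z := by
  rcases hpq with ⟨rfl, rfl⟩ | ⟨rfl, rfl⟩ | ⟨rfl, rfl⟩ <;>
  rcases huv with ⟨rfl, rfl⟩ | ⟨rfl, rfl⟩ | ⟨rfl, rfl⟩ <;>
  · unfold Cr
    omega

theorem alternating_triple {n a b c x y z : ℕ} {h : a < b ∧ b < c ∧ c < n}
    {h' : x < y ∧ y < z ∧ z < n} :
    Alternating (triple a b c h).1 (triple x y z h').1 ↔ Cr a b c x y z := by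
  constructor
  · rintro ⟨⟨p, _⟩, hp, ⟨q, _⟩, hq, ⟨u, _⟩, hu, ⟨v, _⟩, hv, hlt⟩
    simp only [triple, Finset.mem_sdiff, Finset.mem_insert, Finset.mem_singleton, Fin.mk.injEq,
      Fin.mk_lt_mk, not_or] at hp hq hu hv hlt
    have hpq : (p = a ∧ q = b) ∨ (p = a ∧ q = c) ∨ (p = b ∧ q = c) := by
      have hlt : p < q := by omega
      clear hu hv
      omega
    have huv : (u = x ∧ v = y) ∨ (u = x ∧ v = z) ∨ (u = y ∧ v = z) := by
      have hlt : u < v := by omega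
      clear hp hq hpq
      omega
    exact Cr.of_alternate h.1 h.2.1 h'.1 h'.2.1 hpq huv hp.2 hq.2 hu.2 hv.2 hlt
  · have key : ∀ p q u v : ℕ, (p = a ∨ p = b ∨ p = c) → (q = a ∨ q = b ∨ q = c) →
        (u = x ∨ u = y ∨ u = z) → (v = x ∨ v = y ∨ v = z) → (p ≠ x ∧ p ≠ y ∧ p ≠ z) →
        (q ≠ x ∧ q ≠ y ∧ q ≠ z) → (u ≠ a ∧ u ≠ b ∧ u ≠ c) → (v ≠ a ∧ v ≠ b ∧ v ≠ c) →
        ((p < u ∧ u < q ∧ q < v) ∨ (u < p ∧ p < v ∧ v < q)) →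
        Alternating (triple a b c h).1 (triple x y z h').1 := by
      intro p q u v hp hq hu hv hp' hq' hu' hv' hlt
      exact ⟨⟨p, by omega⟩, by simpa [triple] using ⟨hp, hp'⟩, ⟨q, by omega⟩,
        by simpa [triple] using ⟨hq, hq'⟩, ⟨u, by omega⟩, by simpa [triple] using ⟨hu, hu'⟩,
        ⟨v, by omega⟩, by simpa [triple] using ⟨hv, hv'⟩, hlt⟩
    intro hc
    rcases hc with ⟨_, _ | _⟩ | ⟨_, ⟨_, _, _, _⟩ | ⟨_, _, _, _⟩⟩ | ⟨_, ⟨_, _, _, _⟩ | ⟨_, _, _, _⟩⟩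
    · exact key b c y z (by simp) (by simp) (by simp) (by simp) (by omega) (by omega) (by omega)
        (by omega) (by omega)
    · exact key b c y z (by simp) (by simp) (by simp) (by simp) (by omega) (by omega) (by omega)
        (by omega) (by omega)
    -- The alternation is a < x < b < z, except that a shared z = c must be replaced by y; the later
    -- splits avoid shared elements likewise.
    · by_cases h0 : z = c
      · exact key a b x y (by simp) (by simp) (by simp) (by simp) (by omega) (by omega) (by omega)
          (by omega) (by omega)
      · exact key a b x z (by simp) (by simp) (by simp) (by simp) (by omega) (by omega) (by omega)
          (by omega) (by omega)
    · by_cases h0 : x = b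
      · exact key a c y z (by simp) (by simp) (by simp) (by simp) (by omega) (by omega) (by omega)
          (by omega) (by omega)
      · exact key a c x z (by simp) (by simp) (by simp) (by simp) (by omega) (by omega) (by omega)
          (by omega) (by omega)
    · by_cases h0 : z = c
      · exact key a b x y (by simp) (by simp) (by simp) (by simp) (by omega) (by omega) (by omega)
          (by omega) (by omega)
      · exact key a c x y (by simp) (by simp) (by simp) (by simp) (by omega) (by omega) (by omega)
          (by omega) (by omega)
    · by_cases h0 : y = a
      · exact key b c x z (by simp) (by simp) (by simp) (by simp) (by omega) (by omega) (by omega)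
          (by omega) (by omega)
      · exact key a c x z (by simp) (by simp) (by simp) (by simp) (by omega) (by omega) (by omega)
          (by omega) (by omega)

theorem alternating_pair {n a b x y : ℕ} {h : a < b ∧ b < n} {h' : x < y ∧ y < n} :
    Alternating (pair a b h).1 (pair x y h').1 ↔ CrPair a b x y := by
  constructor
  · rintro ⟨⟨p, _⟩, hp, ⟨q, _⟩, hq, ⟨u, _⟩, hu, ⟨v, _⟩, hv, hlt⟩
    simp only [pair, Finset.mem_sdiff, Finset.mem_insert, Finset.mem_singleton, Fin.mk.injEq,
      Fin.mk_lt_mk] at hp hq hu hv hlt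
    unfold CrPair
    omega
  · intro hc
    refine ⟨⟨a, by omega⟩, ?_, ⟨b, by omega⟩, ?_, ⟨x, by omega⟩, ?_, ⟨y, by omega⟩, ?_, ?_⟩ <;>
    simp only [pair, Finset.mem_sdiff, Finset.mem_insert, Finset.mem_singleton, Fin.mk.injEq,
      Fin.mk_lt_mk, true_or, or_true, true_and] <;> unfold CrPair at hc <;> omega

theorem IsMaximalWeaklySeparated.not_alternating {k n : ℕ} {C : Set (KSubset k n)}
    (hC : IsMaximalWeaklySeparated C) {I J : KSubset k n} (hI : I ∈ C) (hJ : J ∈ C) :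
    ¬ Alternating I.1 J.1 :=
  (weaklySeparated_iff (I.2.trans J.2.symm)).1 (hC.prop I hI J hJ)

theorem IsMaximalWeaklySeparated.mem {k n : ℕ} {C : Set (KSubset k n)}
    (hC : IsMaximalWeaklySeparated C) {I : KSubset k n}
    (h : ∀ J ∈ C, ¬ Alternating I.1 J.1) : I ∈ C := by
  have hws : ∀ J ∈ C, WeaklySeparated I.1 J.1 := fun J hJ =>
    (weaklySeparated_iff (I.2.trans J.2.symm)).2 (h J hJ)
  refine hC.le_of_ge (y := insert I C) ?_ (Set.subset_insert _ _) (Set.mem_insert _ _)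
  rintro J (rfl | hJ) K (rfl | hK)
  · exact (weaklySeparated_iff rfl).2 fun ⟨p, hp, _⟩ => by simp at hp
  · exact hws K hK
  · exact (hws J hJ).symm
  · exact hC.prop J hJ K hK

theorem IsMaximalWeaklySeparated.maxTriples {n : ℕ} {C : Set (KSubset 3 n)}
    (hC : IsMaximalWeaklySeparated C) : MaxTriples n fun x y z => ∃ h, triple x y z h ∈ C where
  sorted := fun ⟨h, _⟩ => h
  nc := fun ⟨_, h⟩ ⟨_, h'⟩ hcr => hC.not_alternating h h' (alternating_triple.2 hcr)
  max := by
    intro a b c hab hbc hc hall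
    refine ⟨⟨hab, hbc, hc⟩, hC.mem fun J hJ halt => ?_⟩
    obtain ⟨x, y, z, h, rfl⟩ := exists_eq_triple J
    exact hall x y z ⟨h, hJ⟩ (alternating_triple.1 halt)

theorem IsMaximalWeaklySeparated.maxPairs {n : ℕ} {C : Set (KSubset 2 n)}
    (hC : IsMaximalWeaklySeparated C) : MaxPairs n fun x y => ∃ h, pair x y h ∈ C where
  sorted := fun ⟨h, _⟩ => h
  nc := fun ⟨_, h⟩ ⟨_, h'⟩ hcr => hC.not_alternating h h' (alternating_pair.2 hcr)
  max := by
    intro a b hab hb hall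
    refine ⟨⟨hab, hb⟩, hC.mem fun J hJ halt => ?_⟩
    obtain ⟨x, y, h, rfl⟩ := exists_eq_pair J
    exact hall x y ⟨h, hJ⟩ (alternating_pair.1 halt)

/-! ### Positivity of minors under the Plücker relations -/

theorem isPosReal_iff {z : ℂ} : IsPosReal z ↔ ∃ r : ℝ, 0 < r ∧ z = r := by
  constructor
  · rintro ⟨h1, h2⟩
    exact ⟨z.re, h2, Complex.ext rfl (by simpa using h1)⟩
  · rintro ⟨r, hr, rfl⟩
    exact ⟨Complex.ofReal_im r, hr⟩

theorem IsPosReal.exchange_aux {s t u v x y : ℂ} (h : x * y = s * t + u * v) (hs : IsPosReal s)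
    (ht : IsPosReal t) (hu : IsPosReal u) (hv : IsPosReal v) (hx : IsPosReal x) : IsPosReal y := by
  rw [isPosReal_iff] at *
  obtain ⟨s, hs, rfl⟩ := hs
  obtain ⟨t, ht, rfl⟩ := ht
  obtain ⟨u, hu, rfl⟩ := hu
  obtain ⟨v, hv, rfl⟩ := hv
  obtain ⟨x, hx, rfl⟩ := hx
  refine ⟨(s * t + u * v) / x, by positivity, ?_⟩
  have : (x : ℂ) ≠ 0 := by exact_mod_cast hx.ne'
  push_cast
  rw [← h, mul_div_cancel_left₀ _ this]

theorem IsPosReal.exchange {s t u v x y : ℂ} (h : x * y = s * t + u * v) (hs : IsPosReal s)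
    (ht : IsPosReal t) (hu : IsPosReal u) (hv : IsPosReal v) : IsPosReal x ↔ IsPosReal y :=
  ⟨IsPosReal.exchange_aux h hs ht hu hv,
    IsPosReal.exchange_aux ((mul_comm y x).trans h) hs ht hu hv⟩

/-- The columns of a matrix, extended by zero. -/
noncomputable def column {k n : ℕ} (M : Matrix (Fin k) (Fin n) ℂ) (i : Fin k) (j : ℕ) : ℂ :=
  if h : j < n then M i ⟨j, h⟩ else 0

/-- The minor of a `3 × n` matrix on three columns. -/
noncomputable def minor₃ {n : ℕ} (M : Matrix (Fin 3) (Fin n) ℂ) (x y z : ℕ) : ℂ :=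
  (Matrix.of fun i => ![column M i x, column M i y, column M i z]).det

/-- The minor of a `2 × n` matrix on two columns. -/
noncomputable def minor₂ {n : ℕ} (M : Matrix (Fin 2) (Fin n) ℂ) (x y : ℕ) : ℂ :=
  (Matrix.of fun i => ![column M i x, column M i y]).det

theorem plucker_triple {n : ℕ} (M : Matrix (Fin 3) (Fin n) ℂ) {x y z : ℕ}
    (h : x < y ∧ y < z ∧ z < n) : plucker M (triple x y z h) = minor₃ M x y z := by
  have he := Finset.orderEmbOfFin_unique (triple x y z h).2
    (f := ![⟨x, by omega⟩, ⟨y, by omega⟩, ⟨z, by omega⟩])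
    (fun i => by fin_cases i <;> simp [triple])
    (by
      rw [Fin.strictMono_iff_lt_succ]
      intro i
      fin_cases i
      exacts [h.1, h.2.1])
  rw [plucker, minor₃, ← he]
  congr 1
  ext i j
  fin_cases j <;> simp [column, h.2.2, h.2.1.trans h.2.2, h.1.trans (h.2.1.trans h.2.2)]

theorem plucker_pair {n : ℕ} (M : Matrix (Fin 2) (Fin n) ℂ) {x y : ℕ}
    (h : x < y ∧ y < n) : plucker M (pair x y h) = minor₂ M x y := by
  have he := Finset.orderEmbOfFin_unique (pair x y h).2 (f := ![⟨x, by omega⟩, ⟨y, by omega⟩])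
    (fun i => by fin_cases i <;> simp [pair])
    (by
      rw [Fin.strictMono_iff_lt_succ]
      intro i
      fin_cases i
      exact h.1)
  rw [plucker, minor₂, ← he]
  congr 1
  ext i j
  fin_cases j <;> simp [column, h.2, h.1.trans h.2]

theorem minor₃_eq {n : ℕ} (M : Matrix (Fin 3) (Fin n) ℂ) (x y z : ℕ) : minor₃ M x y z =
    column M 0 x * column M 1 y * column M 2 z - column M 0 x * column M 1 z * column M 2 y -
    column M 0 y * column M 1 x * column M 2 z + column M 0 y * column M 1 z * column M 2 x +
    column M 0 z * column M 1 x * column M 2 y - column M 0 z * column M 1 y * column M 2 x := by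
  rw [minor₃, Matrix.det_fin_three]
  simp

theorem minor₂_eq {n : ℕ} (M : Matrix (Fin 2) (Fin n) ℂ) (x y : ℕ) : minor₂ M x y =
    column M 0 x * column M 1 y - column M 0 y * column M 1 x := by
  rw [minor₂, Matrix.det_fin_two]
  simp

/-- Each rule is the three-term relation of four columns with a fifth common column; increasing
column order makes every sign positive. -/
theorem exClosed_minor₃ {n : ℕ} (M : Matrix (Fin 3) (Fin n) ℂ) :
    ExClosed n fun x y z => IsPosReal (minor₃ M x y z) := by
  constructor <;> intro a b c d e _ _ _ _ _ h1 h2 h3 h4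
  · exact IsPosReal.exchange (by simp only [minor₃_eq]; ring) h1 h3 h2 h4
  · exact IsPosReal.exchange (by simp only [minor₃_eq]; ring) h1 h3 h2 h4
  · exact IsPosReal.exchange (by simp only [minor₃_eq]; ring) h1 h3 h2 h4
  · exact IsPosReal.exchange (by simp only [minor₃_eq]; ring) h1 h3 h2 h4
  · exact IsPosReal.exchange (by simp only [minor₃_eq]; ring) h1 h3 h2 h4

theorem exClosedPair_minor₂ {n : ℕ} (M : Matrix (Fin 2) (Fin n) ℂ) :
    ExClosedPair n fun x y => IsPosReal (minor₂ M x y) := by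
  intro a b c d _ _ _ _ h1 h2 h3 h4
  exact IsPosReal.exchange (by simp only [minor₂_eq]; ring) h1 h3 h2 h4

theorem IsMaximalWeaklySeparated.isPosReal_plucker {k n : ℕ} (hk : k = 2 ∨ k = 3)
    {C : Set (KSubset k n)} (hC : IsMaximalWeaklySeparated C) (M : Matrix (Fin k) (Fin n) ℂ)
    (hM : ∀ I ∈ C, IsPosReal (plucker M I)) (J : KSubset k n) : IsPosReal (plucker M J) := by
  rcases hk with rfl | rfl
  · obtain ⟨x, y, h, rfl⟩ := exists_eq_pair J
    rw [plucker_pair]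
    exact all_pairs_mem hC.maxPairs (exClosedPair_minor₂ M)
      (fun x y ⟨h, hI⟩ => plucker_pair M h ▸ hM _ hI) x y h.1 h.2
  · obtain ⟨x, y, z, h, rfl⟩ := exists_eq_triple J
    rw [plucker_triple]
    exact all_triples_mem hC.maxTriples (exClosed_minor₃ M)
      (fun x y z ⟨h, hI⟩ => plucker_triple M h ▸ hM _ hI) x y z h.1 h.2.1 h.2.2

end GrassmannPositivity

theorem mainTheorem9 (k n : ℕ) (hk : k = 2 ∨ k = 3)
    (C : Set (GrassmannPositivity.KSubset k n))
    (hC : GrassmannPositivity.IsMaximalWeaklySeparated C) :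
    GrassmannPositivity.IsPositivityTest C ∧
      ∀ (p : GrassmannPositivity.Grassmannian k n) (M : Matrix (Fin k) (Fin n) ℂ),
        GrassmannPositivity.Represents M p →
        (∀ I ∈ C, GrassmannPositivity.IsPosReal (GrassmannPositivity.plucker M I)) →
        ∀ J : GrassmannPositivity.KSubset k n,
          GrassmannPositivity.IsPosReal (GrassmannPositivity.plucker M J) :=
  ⟨fun _ => ⟨fun ⟨M, hp, h⟩ => ⟨M, hp, fun I _ => h I⟩,
    fun ⟨M, hp, h⟩ => ⟨M, hp, hC.isPosReal_plucker hk M h⟩⟩,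
    fun _ M _ h => hC.isPosReal_plucker hk M h⟩
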